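/- **Setting.** Let $\mathcal A$ be a countable set of labels and write $\mathbb Q_+=\{r\in\mathbb Q: r\ge 0\}$. An *analytic space* is a topological space homeomorphic to an analytic subset of a Polish space (the image of a Polish space under a continuous map between Polish spaces); it carries its Borel $\sigma$-algebra. A *continuous Markov kernel* (CMK) is a tuple $\mathcal M=(M,\Sigma,\theta)$ where $(M,\Sigma)$ is an analytic space with its Borel $\sigma$-algebra and, for each $a\in\mathcal A$, $\theta(a)$ is a measurable map from $M$ to the space $\Delta(M,\Sigma)$ of finite measures on $(M,\Sigma)$ (with the $\sigma$-algebra generated by the sets $\{\mu:\mu(S)\ge r\}$, $S\in\Sigma$, $r>0$). A *continuous Markov process* (CMP) is a pair $(\mathcal M,m)$ with $m\in M$. A *rate-bisimulation* on $\mathcal M$ is an equivalence relation $R$ on $M$ such that $(m,n)\in R$ implies $\theta(a)(m)(C)=\theta(a)(n)(C)$ for all $a\in\mathcal A$ and all $R$-closed $C\in\Sigma$. The processes $(\mathcal M,m)$ and $(\mathcal M',m')$ are *bisimilar*, $(\mathcal M,m)\sim(\mathcal M',m')$, if some rate-bisimulation on the disjoint union $\mathcal M\uplus\mathcal M'$ relates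 $m$ and $m'$. **Logics.** The formulas of $\mathcal L(\mathcal A)$ are $\phi::=\top\mid\neg\phi\mid\phi\wedge\phi\mid L^a_r\phi$, and those of $\mathcal L^+(\mathcal A)$ are $\phi::=\top\mid\neg\phi\mid\phi\wedge\phi\mid L^a_r\phi\mid M^a_r\phi$ ($a\in\mathcal A$, $r\in\mathbb Q_+$). Satisfaction is classical on Boolean operators, and $\mathcal M,m\models L^a_r\phi$ iff $\theta(a)(m)(\llbracket\phi\rrbracket_{\mathcal M})\ge r$, $\mathcal M,m\models M^a_r\phi$ iff $\theta(a)(m)(\llbracket\phi\rrbracket_{\mathcal M})\le r$, where $\llbracket\phi\rrbracket_{\mathcal M}=\{n:\mathcal M,n\models\phi\}$. Let $\mathcal L$ be either of the two logics. Put $\bot=\neg\top$ and $\phi\to\psi=\neg(\phi\wedge\neg\psi)$. The provability relation $\Gamma\vdash\phi$ ($\Gamma\subseteq\mathcal L$, $\phi\in\mathcal L$) is the least relation that contains all instances of propositional tautologies, and satisfies $\Gamma\vdash\phi$ for $\phi\in\Gamma$, infinitary cut (if $\Gamma\vdash\psi$ for all $\psi\in\Delta$ and $\Delta\vdash\phi$,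 then $\Gamma\vdash\phi$), modus ponens, the deduction rule (if $\Gamma\cup\{\phi\}\vdash\psi$ then $\Gamma\vdash\phi\to\psi$), and, for all $a\in\mathcal A$, $r,s\in\mathbb Q_+$ and all formulas: * for both logics: $\vdash L^a_0\phi$; $\ \vdash\neg L^a_r(\phi\wedge\psi)\wedge\neg L^a_s(\phi\wedge\neg\psi)\to\neg L^a_{r+s}\phi$; $\ $ if $\vdash\phi\to\psi$ then $\vdash L^a_r\phi\to L^a_r\psi$; $\ \{L^a_r\phi\mid r<s\}\vdash L^a_s\phi$; $\ \{L^a_r\phi\mid r>s\}\vdash\bot$; * for $\mathcal L(\mathcal A)$: $\vdash L^a_{r+s}\phi\to L^a_r\phi$; $\ \vdash L^a_r(\phi\wedge\psi)\wedge L^a_s(\phi\wedge\neg\psi)\to L^a_{r+s}\phi$; * for $\mathcal L^+(\mathcal A)$: $\vdash L^a_{r+s}\phi\to\neg M^a_r\phi$ if $s>0$; $\ \vdash\neg L^a_r\phi\to M^a_r\phi$; $\ \vdash\neg M^a_r(\phi\wedge\psi)\wedge\neg M^a_s(\phi\wedge\neg\psi)\to\neg M^a_{r+s}\phi$; $\ \{M^a_r\phi\mid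 r>s\}\vdash M^a_s\phi$; * the countable additivity rule: if $\Phi\vdash\phi$ then $\{L^a_r\psi\mid\psi\in\bigwedge\Phi\}\vdash L^a_r\phi$, where $\bigwedge\Phi$ is the set of finite conjunctions of elements of $\Phi$ (the empty conjunction is $\top$). A set $\Gamma$ is *consistent* if $\Gamma\nvdash\bot$, and *maximally consistent* if moreover no formula of $\mathcal L$ outside $\Gamma$ can be added to $\Gamma$ without making it inconsistent. Let $\Omega$ be the set of maximally consistent sets, $(\!|\phi|\!)=\{\Phi\in\Omega\mid\phi\in\Phi\}$, and let $\Omega$ carry the $\sigma$-algebra generated by the sets $(\!|\phi|\!)$. The *canonical model* is the CMK $\mathcal M_{\mathcal L}$ on $\Omega$ with transition function $\theta_{\mathcal L}$ such that, for all $a,\Phi,\phi$, $$\theta_{\mathcal L}(a)(\Phi)\big((\!|\phi|\!)\big)=\sup\{r\mid L^a_r\phi\in\Phi\}=\inf\{r\mid\neg L^a_r\phi\in\Phi\},$$ and, if $\mathcal L=\mathcal L^+(\mathcal A)$, this number is also equal to $\inf\{r\mid M^a_r\phi\in\Phi\}=\sup\{r\mid\neg M^a_r\phi\in\Phi\}$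 (here $r$ ranges over $\mathbb Q_+$ and $\sup\emptyset=0$). **Theorem (Representation Theorem).** Let $\mathcal L\in\{\mathcal L(\mathcal A),\mathcal L^+(\mathcal A)\}$. The canonical model $\mathcal M_{\mathcal L}$ exists and is unique. For every continuous Markov process $P$, the set $\Phi=\{\phi\in\mathcal L\mid P\models\phi\}$ is maximally consistent, and $P\sim(\mathcal M_{\mathcal L},\Phi)$. -/

import Mathlib

open MeasureTheory ProbabilityTheory Topology
open scoped NNReal ENNReal

universe w

/-! ### Analytic spaces -/

/-- A topological space is analytic if it is (up to homeomorphism) an analytic subset of a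
Polish space, i.e. the image of a Polish space under a continuous map between Polish spaces
(this is `MeasureTheory.AnalyticSet`), with the subspace topology. -/
def IsAnalyticSpace (M : Type w) [TopologicalSpace M] : Prop :=
  ∃ (Y : Type w) (_ : TopologicalSpace Y) (_ : PolishSpace Y) (e : M → Y),
    IsEmbedding e ∧ AnalyticSet (Set.range e)

/-- A measurable space is analytic if its σ-algebra is the Borel σ-algebra of some analytic
topology. -/
def IsAnalyticMeasurableSpace (M : Type*) [MeasurableSpace M] : Prop :=
  ∃ _ : TopologicalSpace M, IsAnalyticSpace M ∧ BorelSpace M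

theorem isAnalyticSpace_sum {M : Type*} {M' : Type*} [TopologicalSpace M] [TopologicalSpace M']
    (h : IsAnalyticSpace M) (h' : IsAnalyticSpace M') : IsAnalyticSpace (M ⊕ M') := by
  obtain ⟨Y, _, _, e, he, hr⟩ := h
  obtain ⟨Y', _, _, e', he', hr'⟩ := h'
  refine ⟨Y ⊕ Y', inferInstance, inferInstance,
    Sum.elim (Sum.inl ∘ e) (Sum.inr ∘ e'), ?_, ?_⟩
  · refine IsEmbedding.sumElim_of_separatedNhds (IsEmbedding.inl.comp he)
      (IsEmbedding.inr.comp he') ?_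
    refine ⟨Set.range Sum.inl, Set.range Sum.inr, isOpen_range_inl, isOpen_range_inr, ?_, ?_, ?_⟩
    · exact Set.range_comp_subset_range _ _
    · exact Set.range_comp_subset_range _ _
    · exact Set.isCompl_range_inl_range_inr.disjoint
  · have hu : Set.range (Sum.elim (Sum.inl ∘ e) (Sum.inr ∘ e') : M ⊕ M' → Y ⊕ Y') =
        ⋃ b : Bool, cond b (Sum.inl '' Set.range e) (Sum.inr '' Set.range e') := by
      rw [Set.Sum.elim_range, Set.range_comp, Set.range_comp, Set.union_eq_iUnion]
    rw [hu]
    refine AnalyticSet.iUnion fun b => ?_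
    cases b
    · exact hr'.image_of_continuous continuous_inr
    · exact hr.image_of_continuous continuous_inl

theorem borelSpace_sum {M : Type*} {M' : Type*} [TopologicalSpace M] [TopologicalSpace M']
    [MeasurableSpace M] [MeasurableSpace M'] [BorelSpace M] [BorelSpace M'] :
    BorelSpace (M ⊕ M') := by
  refine ⟨le_antisymm ?_ ?_⟩
  · intro s hs
    obtain ⟨h1, h2⟩ := measurableSet_sum_iff.1 hs
    let _ : MeasurableSpace (M ⊕ M') := borel (M ⊕ M')
    have : BorelSpace (M ⊕ M') := ⟨rfl⟩
    have e1 := (IsOpenEmbedding.inl (X := M) (Y := M')).measurableEmbedding.measurableSet_image' h1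
    have e2 := (IsOpenEmbedding.inr (X := M) (Y := M')).measurableEmbedding.measurableSet_image' h2
    have : s = Sum.inl '' (Sum.inl ⁻¹' s) ∪ Sum.inr '' (Sum.inr ⁻¹' s) := by
      rw [Set.image_preimage_inl_union_image_preimage_inr]
    rw [this]
    exact e1.union e2
  · refine MeasurableSpace.generateFrom_le fun s hs => ?_
    obtain ⟨h1, h2⟩ := isOpen_sum_iff.1 hs
    exact measurableSet_sum_iff.2 ⟨h1.measurableSet, h2.measurableSet⟩

theorem isAnalyticMeasurableSpace_sum {M : Type*} {M' : Type*} [MeasurableSpace M]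
    [MeasurableSpace M'] (h : IsAnalyticMeasurableSpace M) (h' : IsAnalyticMeasurableSpace M') :
    IsAnalyticMeasurableSpace (M ⊕ M') := by
  obtain ⟨_, ha, _⟩ := h
  obtain ⟨_, ha', _⟩ := h'
  exact ⟨inferInstance, isAnalyticSpace_sum ha ha', borelSpace_sum⟩

/-! ### Continuous Markov processes and stochastic bisimulation -/

/-- An `A`-continuous Markov kernel (CMK) with support set `M`: the measurable space `M` is
analytic, and every label `a` is assigned a measurable map `rate a` from `M` to the finite measures
on `M`.  A continuous Markov process (CMP) is such a kernel together with a state `m : M`. -/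
@[ext]
structure CMK (A : Type*) (M : Type*) [MeasurableSpace M] where
  rate : A → Kernel M M
  finite_rate : ∀ a m, IsFiniteMeasure (rate a m)
  analytic : IsAnalyticMeasurableSpace M

/-- The subset `C` is closed under the relation `R`. -/
def RelClosed {M : Type*} (R : M → M → Prop) (C : Set M) : Prop :=
  {m | ∃ n ∈ C, R n m} ⊆ C

/-- Rate-bisimulation on a CMK: an equivalence relation such that related states have the same
rates into all measurable `R`-closed sets. -/
def CMK.IsRateBisimulation {A : Type*} {M : Type*} [MeasurableSpace M] (K : CMK A M)
    (R : M → M → Prop) : Prop :=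
  Equivalence R ∧ ∀ m n, R m n → ∀ C, MeasurableSet C → RelClosed R C →
    ∀ a, K.rate a m C = K.rate a n C

/-- Stochastic bisimilarity of two states of the same CMK. -/
def CMK.StateBisimilar {A : Type*} {M : Type*} [MeasurableSpace M] (K : CMK A M)
    (m n : M) : Prop :=
  ∃ R : M → M → Prop, K.IsRateBisimulation R ∧ R m n

/-- The disjoint union of two CMKs: from a state of either summand one moves inside this summand,
with its rates. -/
noncomputable def CMK.disjointUnion {A : Type*} {M : Type*} {M' : Type*} [MeasurableSpace M]
    [MeasurableSpace M'] (K : CMK A M) (K' : CMK A M') : CMK A (M ⊕ M') where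
  rate a :=
    { toFun := Sum.elim (fun m => (K.rate a m).map Sum.inl) (fun m' => (K'.rate a m').map Sum.inr)
      measurable' := Measurable.sumElim
        ((Measure.measurable_map _ measurable_inl).comp (K.rate a).measurable)
        ((Measure.measurable_map _ measurable_inr).comp (K'.rate a).measurable) }
  finite_rate a x := by
    cases x with
    | inl m =>
      have := K.finite_rate a m
      exact Measure.isFiniteMeasure_map (K.rate a m) Sum.inl
    | inr m' =>
      have := K'.finite_rate a m'
      exact Measure.isFiniteMeasure_map (K'.rate a m') Sum.inr
  analytic := isAnalyticMeasurableSpace_sum K.analytic K'.analytic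

/-- Bisimilarity of the processes `(K, m)` and `(K', m')`: bisimilarity of the two states in the
disjoint union. -/
def Bisimilar {A : Type*} {M : Type*} {M' : Type*} [MeasurableSpace M] [MeasurableSpace M']
    (K : CMK A M) (m : M) (K' : CMK A M') (m' : M') : Prop :=
  (K.disjointUnion K').StateBisimilar (Sum.inl m) (Sum.inr m')

/-! ### The logics -/

/-- The two continuous Markovian logics: `base` has only the operators "rate at least `r`",
`full` has in addition the operators "rate at most `r`". -/
inductive CML where
  | base
  | full

/-- Formulas; the operators `atMost` (`M^a_r`) are present only in the full logic. -/
inductive Formula (A : Type*) (ℓ : CML) where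
  | top : Formula A ℓ
  | neg : Formula A ℓ → Formula A ℓ
  | and : Formula A ℓ → Formula A ℓ → Formula A ℓ
  | atLeast : A → ℚ≥0 → Formula A ℓ → Formula A ℓ
  | atMost : ℓ = CML.full → A → ℚ≥0 → Formula A ℓ → Formula A ℓ

namespace Formula

variable {A : Type*} {ℓ : CML}

def bot : Formula A ℓ := neg top

def imp (φ ψ : Formula A ℓ) : Formula A ℓ := neg (and φ (neg ψ))

/-- Finite conjunctions; the empty one is `top`. -/
def conj : List (Formula A ℓ) → Formula A ℓ
  | [] => top
  | φ :: l => and φ (conj l)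

/-- The set of states of `K` that satisfy a formula. -/
def sat {M : Type*} [MeasurableSpace M] (K : CMK A M) : Formula A ℓ → Set M
  | top => Set.univ
  | neg φ => (sat K φ)ᶜ
  | and φ ψ => sat K φ ∩ sat K ψ
  | atLeast a r φ => {m | ((r : ℝ≥0) : ℝ≥0∞) ≤ K.rate a m (sat K φ)}
  | atMost _ a r φ => {m | K.rate a m (sat K φ) ≤ ((r : ℝ≥0) : ℝ≥0∞)}

/-- Instances of propositional tautologies: formulas that are true under every assignment of truth
values to all formulas that respects `top`, `neg` and `and`. -/
def IsTautology (φ : Formula A ℓ) : Prop :=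
  ∀ v : Formula A ℓ → Prop, v top → (∀ ψ, v (neg ψ) ↔ ¬ v ψ) →
    (∀ ψ χ, v (and ψ χ) ↔ v ψ ∧ v χ) → v φ

/-- The set of finite conjunctions of elements of `Φ`. -/
def conjunctions (Φ : Set (Formula A ℓ)) : Set (Formula A ℓ) :=
  {χ | ∃ l : List (Formula A ℓ), (∀ ψ ∈ l, ψ ∈ Φ) ∧ χ = conj l}

/-- The infinitary provability relation `Γ ⊢ φ`: propositional logic with the structural rules of
infinitary deduction, the axioms and rules of the logic in question, and the countable additivity
rule `car`. -/
inductive Provable : Set (Formula A ℓ) → Formula A ℓ → Prop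
  | hyp {Γ φ} : φ ∈ Γ → Provable Γ φ
  | cut {Γ Δ φ} : (∀ ψ ∈ Δ, Provable Γ ψ) → Provable Δ φ → Provable Γ φ
  | taut {Γ φ} : IsTautology φ → Provable Γ φ
  | modusPonens {Γ φ ψ} : Provable Γ (imp φ ψ) → Provable Γ φ → Provable Γ ψ
  | deduction {Γ φ ψ} : Provable (insert φ Γ) ψ → Provable Γ (imp φ ψ)
  -- axioms and rules common to both logics
  | atLeast_zero (a φ) : Provable ∅ (atLeast a 0 φ)
  | not_atLeast_add (a r s φ ψ) : Provable ∅
      (imp (and (neg (atLeast a r (and φ ψ))) (neg (atLeast a s (and φ (neg ψ)))))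
        (neg (atLeast a (r + s) φ)))
  | atLeast_mono (a r) {φ ψ} : Provable ∅ (imp φ ψ) →
      Provable ∅ (imp (atLeast a r φ) (atLeast a r ψ))
  | atLeast_of_lt (a s φ) : Provable {χ | ∃ r < s, χ = atLeast a r φ} (atLeast a s φ)
  | bot_of_gt (a s φ) : Provable {χ | ∃ r > s, χ = atLeast a r φ} bot
  -- axioms of the base logic
  | atLeast_le (a r s φ) : ℓ = CML.base →
      Provable ∅ (imp (atLeast a (r + s) φ) (atLeast a r φ))
  | atLeast_add (a r s φ ψ) : ℓ = CML.base → Provable ∅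
      (imp (and (atLeast a r (and φ ψ)) (atLeast a s (and φ (neg ψ)))) (atLeast a (r + s) φ))
  -- axioms and rules of the full logic
  | not_atMost_of_atLeast (h : ℓ = CML.full) (a r s φ) : 0 < s →
      Provable ∅ (imp (atLeast a (r + s) φ) (neg (atMost h a r φ)))
  | atMost_of_not_atLeast (h : ℓ = CML.full) (a r φ) :
      Provable ∅ (imp (neg (atLeast a r φ)) (atMost h a r φ))
  | not_atMost_add (h : ℓ = CML.full) (a r s φ ψ) : Provable ∅
      (imp (and (neg (atMost h a r (and φ ψ))) (neg (atMost h a s (and φ (neg ψ)))))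
        (neg (atMost h a (r + s) φ)))
  | atMost_of_gt (h : ℓ = CML.full) (a s φ) :
      Provable {χ | ∃ r > s, χ = atMost h a r φ} (atMost h a s φ)
  -- countable additivity rule
  | car (a r) {Φ φ} : Provable Φ φ →
      Provable {χ | ∃ ψ ∈ conjunctions Φ, χ = atLeast a r ψ} (atLeast a r φ)

def Consistent (Γ : Set (Formula A ℓ)) : Prop := ¬ Provable Γ bot

/-- `Γ` is consistent, and no formula can be added to it without making it inconsistent. -/
def MaxConsistent (Γ : Set (Formula A ℓ)) : Prop :=
  Consistent Γ ∧ ∀ φ, φ ∉ Γ → ¬ Consistent (insert φ Γ)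

end Formula

/-- The set of formulas of the logic `ℓ` that are satisfied by the process `(K, m)`. -/
def CMK.theory {A : Type*} {M : Type*} [MeasurableSpace M] (K : CMK A M) (ℓ : CML) (m : M) :
    Set (Formula A ℓ) :=
  {φ | m ∈ φ.sat K}

/-! ### The canonical model -/

/-- The state space of the canonical model: the maximally consistent sets of formulas. -/
def CanonicalState (A : Type*) (ℓ : CML) : Type _ :=
  {Φ : Set (Formula A ℓ) // Formula.MaxConsistent Φ}

/-- The set of maximally consistent sets that contain `φ`. -/
def truthSet {A : Type*} {ℓ : CML} (φ : Formula A ℓ) : Set (CanonicalState A ℓ) :=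
  {Φ | φ ∈ Φ.1}

/-- The σ-algebra generated by the truth sets of formulas. -/
instance (A : Type*) (ℓ : CML) : MeasurableSpace (CanonicalState A ℓ) :=
  MeasurableSpace.generateFrom (Set.range truthSet)

/-- `x` is the canonical rate `a^Φ_φ`: the common value of
`sup {r | L^a_r φ ∈ Φ}` and `inf {r | ¬ L^a_r φ ∈ Φ}`, and for the full logic also of
`inf {r | M^a_r φ ∈ Φ}` and `sup {r | ¬ M^a_r φ ∈ Φ}`
(extrema in `[0, ∞]`). -/
structure IsCanonicalRate {A : Type*} {ℓ : CML} (Φ : CanonicalState A ℓ) (a : A)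
    (φ : Formula A ℓ) (x : ℝ≥0∞) : Prop where
  sup_atLeast : IsLUB {y | ∃ r : ℚ≥0, Formula.atLeast a r φ ∈ Φ.1 ∧ y = ((r : ℝ≥0) : ℝ≥0∞)} x
  inf_not_atLeast :
    IsGLB {y | ∃ r : ℚ≥0, Formula.neg (Formula.atLeast a r φ) ∈ Φ.1 ∧
      y = ((r : ℝ≥0) : ℝ≥0∞)} x
  inf_atMost (h : ℓ = CML.full) :
    IsGLB {y | ∃ r : ℚ≥0, Formula.atMost h a r φ ∈ Φ.1 ∧ y = ((r : ℝ≥0) : ℝ≥0∞)} x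
  sup_not_atMost (h : ℓ = CML.full) :
    IsLUB {y | ∃ r : ℚ≥0, Formula.neg (Formula.atMost h a r φ) ∈ Φ.1 ∧
      y = ((r : ℝ≥0) : ℝ≥0∞)} x

/-- `K` is the canonical model of the logic `ℓ`: a CMK on the space of maximally consistent sets
whose rates into truth sets are the canonical ones. -/
def IsCanonicalModel {A : Type*} {ℓ : CML} (K : CMK A (CanonicalState A ℓ)) : Prop :=
  ∀ a Φ φ, IsCanonicalRate Φ a φ (K.rate a Φ (truthSet φ))

/-! Maximal consistency quantifies over infinitary derivations, so it is replaced by a condition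
that a measure can test. A saturated theory is a Boolean-complete set of formulas that contains all
theorems and is closed under the countable family `coreRules`. For such a theory the numbers
`rateSup` form a finite additive content on the truth sets of the Stone space of complete theories.
Compactness of that space makes the content σ-subadditive, and Carathéodory extension yields a
measure.

The decisive point is `stoneMeasure_rule`: the theories violating a given core rule are null. If
they had measure above some rational `r > 0`, every finite conjunction of the premises and the
negated conclusion would have rate at least `r`. The instance `ruleStep` of countable additivity,
itself a core rule, would then give `⊥` rate at least `r`, against `rateSup_bot`. Since there are
countably many core rules, saturated theories are conull, and the measure restricts to them.

This gives a kernel on saturated theories in which, by the truth lemma `sat_eq_basic`, each state is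
its own theory. Soundness makes theories of states maximally consistent, so saturated and maximally
consistent sets coincide. Uniqueness holds because truth sets form a π-system. For any process, the
map from states to theories transports rates to canonical rates; having the same image under it is
the required bisimulation. -/

/-! ### Rational approximation in `[0, ∞]` -/

theorem ENNReal.exists_nnrat_btwn {x y : ℝ≥0∞} (h : x < y) :
    ∃ r : ℚ≥0, x < ((r : ℝ≥0) : ℝ≥0∞) ∧ ((r : ℝ≥0) : ℝ≥0∞) < y := by
  obtain ⟨q, hq, h1, h2⟩ := ENNReal.lt_iff_exists_rat_btwn.1 h
  lift q to ℚ≥0 using hq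
  have : Real.toNNReal ((q : ℚ) : ℝ) = (q : ℝ≥0) := by
    apply NNReal.eq
    rw [Real.coe_toNNReal _ (by positivity)]
    simp
    norm_cast
  exact ⟨q, this ▸ h1, this ▸ h2⟩

theorem ENNReal.coe_nnrat_le_coe {r s : ℚ≥0} :
    ((r : ℝ≥0) : ℝ≥0∞) ≤ ((s : ℝ≥0) : ℝ≥0∞) ↔ r ≤ s := by
  rw [ENNReal.coe_le_coe]; exact_mod_cast Iff.rfl

theorem ENNReal.coe_nnrat_lt_coe {r s : ℚ≥0} :
    ((r : ℝ≥0) : ℝ≥0∞) < ((s : ℝ≥0) : ℝ≥0∞) ↔ r < s := by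
  rw [ENNReal.coe_lt_coe]; exact_mod_cast Iff.rfl

theorem ENNReal.le_add_of_forall_nnrat {x y z : ℝ≥0∞} (hx : x ≠ ∞) (hy : y ≠ ∞)
    (h : ∀ r s : ℚ≥0, x < ((r : ℝ≥0) : ℝ≥0∞) → y < ((s : ℝ≥0) : ℝ≥0∞) →
      z ≤ (((r + s : ℚ≥0) : ℝ≥0) : ℝ≥0∞)) : z ≤ x + y := by
  refine ENNReal.le_of_forall_pos_le_add fun ε hε _ => ?_
  have hε' : (ε / 2 : ℝ≥0∞) ≠ 0 := by simpa [ENNReal.div_eq_zero_iff] using hε.ne'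
  obtain ⟨r, hr, hr'⟩ := ENNReal.exists_nnrat_btwn (ENNReal.lt_add_right hx hε')
  obtain ⟨s, hs, hs'⟩ := ENNReal.exists_nnrat_btwn (ENNReal.lt_add_right hy hε')
  refine (h r s hr hs).trans ?_
  push_cast
  calc _ ≤ (x + ε / 2) + (y + ε / 2) := add_le_add hr'.le hs'.le
    _ = x + y + (ε / 2 + ε / 2) := by ring
    _ = _ := by rw [ENNReal.add_halves]

/-- The hypotheses `hx` and `hy` handle a zero summand, below which there is no rational to test
with. -/
theorem ENNReal.add_le_of_forall_nnrat {x y z : ℝ≥0∞} (hx : x ≤ z) (hy : y ≤ z)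
    (h : ∀ r s : ℚ≥0, ((r : ℝ≥0) : ℝ≥0∞) < x → ((s : ℝ≥0) : ℝ≥0∞) < y →
      (((r + s : ℚ≥0) : ℝ≥0) : ℝ≥0∞) ≤ z) : x + y ≤ z := by
  rcases eq_or_ne x 0 with rfl | hx0
  · simpa using hy
  rcases eq_or_ne y 0 with rfl | hy0
  · simpa using hx
  refine le_of_forall_lt fun c hc => ?_
  obtain ⟨u, v, hu, hv, hcuv⟩ : ∃ u v, u < x ∧ v < y ∧ c < u + v := by
    obtain ⟨u, hu, v, hv, huv⟩ := ENNReal.exists_lt_add_of_lt_add hc hx0 hy0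
    exact ⟨u, v, hu, hv, huv⟩
  obtain ⟨r, hr, hr'⟩ := ENNReal.exists_nnrat_btwn hu
  obtain ⟨s, hs, hs'⟩ := ENNReal.exists_nnrat_btwn hv
  have := h r s hr' hs'
  push_cast at this
  exact hcuv.trans_le ((add_le_add hr.le hs.le).trans this)

/-! ### Countability of the set of formulas -/

namespace Formula

variable {A : Type*} {ℓ : CML}

/-- Formulas of nesting depth at most `n`. -/
def ofDepth (A : Type*) (ℓ : CML) : ℕ → Set (Formula A ℓ)
  | 0 => {top}
  | n + 1 => ofDepth A ℓ n ∪ (neg '' ofDepth A ℓ n ∪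
      (Set.image2 and (ofDepth A ℓ n) (ofDepth A ℓ n) ∪
      ((⋃ p : A × ℚ≥0, atLeast p.1 p.2 '' ofDepth A ℓ n) ∪
        ⋃ (h : ℓ = CML.full) (p : A × ℚ≥0), atMost h p.1 p.2 '' ofDepth A ℓ n)))

theorem ofDepth_mono : Monotone (ofDepth A ℓ) :=
  monotone_nat_of_le_succ fun _ => Set.subset_union_left

theorem countable_ofDepth [Countable A] (n : ℕ) : (ofDepth A ℓ n).Countable := by
  induction n with
  | zero => exact Set.countable_singleton _
  | succ n ih =>
    refine ih.union ((ih.image _).union ((ih.image2 ih _).union (.union ?_ ?_)))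
    · exact Set.countable_iUnion fun p => ih.image _
    · exact Set.countable_iUnion fun h => Set.countable_iUnion fun p => ih.image _

theorem exists_mem_ofDepth (φ : Formula A ℓ) : ∃ n, φ ∈ ofDepth A ℓ n := by
  induction φ with
  | top => exact ⟨0, rfl⟩
  | neg φ ih =>
    obtain ⟨n, hn⟩ := ih
    exact ⟨n + 1, .inr (.inl ⟨φ, hn, rfl⟩)⟩
  | and φ ψ ih ih' =>
    obtain ⟨n, hn⟩ := ih
    obtain ⟨k, hk⟩ := ih'
    exact ⟨max n k + 1, .inr (.inr (.inl ⟨φ, ofDepth_mono (le_max_left _ _) hn, ψ,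
      ofDepth_mono (le_max_right _ _) hk, rfl⟩))⟩
  | atLeast a r φ ih =>
    obtain ⟨n, hn⟩ := ih
    exact ⟨n + 1, .inr (.inr (.inr (.inl (Set.mem_iUnion.2 ⟨(a, r), φ, hn, rfl⟩))))⟩
  | atMost h a r φ ih =>
    obtain ⟨n, hn⟩ := ih
    exact ⟨n + 1, .inr (.inr (.inr (.inr
      (Set.mem_iUnion.2 ⟨h, Set.mem_iUnion.2 ⟨(a, r), φ, hn, rfl⟩⟩))))⟩

instance [Countable A] : Countable (Formula A ℓ) := by
  rw [← Set.countable_univ_iff]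
  refine (Set.countable_iUnion (countable_ofDepth (A := A) (ℓ := ℓ))).mono fun φ _ => ?_
  exact Set.mem_iUnion.2 (exists_mem_ofDepth φ)

/-! ### Propositional logic -/

/-- Truth assignments that respect the Boolean connectives. -/
structure IsValuation (v : Formula A ℓ → Prop) : Prop where
  top : v top
  neg : ∀ ψ, v (neg ψ) ↔ ¬ v ψ
  and : ∀ ψ χ, v (and ψ χ) ↔ v ψ ∧ v χ

namespace IsValuation

variable {v : Formula A ℓ → Prop}

theorem imp (h : IsValuation v) (φ ψ : Formula A ℓ) : v (imp φ ψ) ↔ (v φ → v ψ) := by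
  simp only [Formula.imp, h.neg, h.and]; tauto

theorem not_bot (h : IsValuation v) : ¬ v bot := by
  simp only [bot, h.neg, h.top]; tauto

theorem conj (h : IsValuation v) (l : List (Formula A ℓ)) : v (conj l) ↔ ∀ ψ ∈ l, v ψ := by
  induction l with
  | nil => simp [Formula.conj, h.top]
  | cons φ l ih => simp [Formula.conj, h.and, ih]

end IsValuation

/-- Compactness of propositional logic. -/
theorem exists_list_of_entails (Ξ : Set (Formula A ℓ)) (φ : Formula A ℓ)
    (h : ∀ v, IsValuation v → (∀ ξ ∈ Ξ, v ξ) → v φ) :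
    ∃ l : List (Formula A ℓ), (∀ ξ ∈ l, ξ ∈ Ξ) ∧
      ∀ v, IsValuation v → (∀ ξ ∈ l, v ξ) → v φ := by
  -- The valuations refuting `φ` form a closed, hence compact, subset of a product of copies of
  -- `Bool`; the premises cut it down to the empty set, so finitely many already do.
  let K : Set (Formula A ℓ → Bool) := {v | IsValuation (fun ψ => v ψ = true) ∧ v φ = false}
  have hclosed : ∀ (ψ : Formula A ℓ) (b : Bool), IsClosed {v : Formula A ℓ → Bool | v ψ = b} :=
    fun ψ b => isClosed_singleton.preimage (continuous_apply ψ)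
  have hK : IsClosed K := by
    have : K = {v | v top = true} ∩ (⋂ ψ, {v | v (neg ψ) = !v ψ}) ∩
        (⋂ ψ, ⋂ χ, {v | v (and ψ χ) = (v ψ && v χ)}) ∩ {v | v φ = false} := by
      ext v
      simp only [K, Set.mem_inter_iff, Set.mem_iInter, Set.mem_ofPred_eq]
      constructor
      · rintro ⟨⟨h1, h2, h3⟩, h4⟩
        refine ⟨⟨⟨h1, fun ψ => ?_⟩, fun ψ χ => ?_⟩, h4⟩
        · rw [Bool.eq_iff_iff]; simpa using h2 ψ
        · rw [Bool.eq_iff_iff]; simpa using h3 ψ χ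
      · rintro ⟨⟨⟨h1, h2⟩, h3⟩, h4⟩
        exact ⟨⟨h1, fun ψ => by simp [h2], fun ψ χ => by simp [h3]⟩, h4⟩
    rw [this]
    refine (((hclosed _ _).inter (isClosed_iInter fun ψ => ?_)).inter
      (isClosed_iInter fun ψ => isClosed_iInter fun χ => ?_)).inter (hclosed _ _)
    · exact isClosed_eq (continuous_apply _) 
        ((continuous_of_discreteTopology (f := not)).comp (continuous_apply ψ))
    · exact isClosed_eq (continuous_apply _)
        ((continuous_of_discreteTopology (f := fun p : Bool × Bool => p.1 && p.2)).comp
          ((continuous_apply (A := fun _ : Formula A ℓ => Bool) ψ).prodMk (continuous_apply χ)))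
  obtain ⟨u, hu⟩ := hK.isCompact.elim_finite_subfamily_closed
    (fun ξ : Ξ => {v : Formula A ℓ → Bool | v ξ = true}) (fun ξ => hclosed _ _) (by
      rw [Set.eq_empty_iff_forall_notMem]
      rintro v ⟨⟨hv, hvφ⟩, hvΞ⟩
      rw [Set.mem_iInter] at hvΞ
      have := h _ hv fun ξ hξ => hvΞ ⟨ξ, hξ⟩
      simp [hvφ] at this)
  refine ⟨u.toList.map Subtype.val, ?_, fun v hv hl => ?_⟩
  · intro ξ hξ
    obtain ⟨ξ', -, rfl⟩ := List.mem_map.1 hξ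
    exact ξ'.2
  · classical
    by_contra hφ
    refine Set.eq_empty_iff_forall_notMem.1 hu (fun ψ => decide (v ψ)) ⟨⟨?_, ?_⟩, ?_⟩
    · simpa using hv
    · simpa using hφ
    · simp only [Set.mem_iInter]
      intro ξ hξ
      simpa using hl ξ (List.mem_map.2 ⟨ξ, by simpa using hξ, rfl⟩)

namespace Provable

theorem mono {Γ Δ : Set (Formula A ℓ)} {φ : Formula A ℓ} (h : Γ ⊆ Δ) (hφ : Provable Γ φ) :
    Provable Δ φ :=
  cut (fun _ hψ => hyp (h hψ)) hφ

theorem of_valuation {Γ : Set (Formula A ℓ)} {φ : Formula A ℓ}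
    (h : ∀ v, IsValuation v → v φ) : Provable Γ φ :=
  taut fun v h1 h2 h3 => h v ⟨h1, h2, h3⟩

theorem of_imp {Γ : Set (Formula A ℓ)} {φ ψ : Formula A ℓ}
    (h : ∀ v, IsValuation v → v φ → v ψ) (hφ : Provable Γ φ) : Provable Γ ψ :=
  modusPonens (of_valuation fun v hv => (hv.imp _ _).2 (h v hv)) hφ

theorem and {Γ : Set (Formula A ℓ)} {φ ψ : Formula A ℓ} (hφ : Provable Γ φ)
    (hψ : Provable Γ ψ) : Provable Γ (φ.and ψ) := by
  refine modusPonens (of_imp (fun v hv h => ?_) hφ) hψ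
  rw [hv.imp, hv.and]; exact fun h' => ⟨h, h'⟩

theorem conj {Γ : Set (Formula A ℓ)} {l : List (Formula A ℓ)} (h : ∀ ψ ∈ l, Provable Γ ψ) :
    Provable Γ (conj l) := by
  induction l with
  | nil => exact of_valuation fun v hv => hv.top
  | cons φ l ih =>
    exact (h φ (by simp)).and (ih fun ψ hψ => h ψ (by simp [hψ]))

/-- Provability is closed under propositional entailment. -/
theorem of_entails {Γ : Set (Formula A ℓ)} {Ξ : Set (Formula A ℓ)} {φ : Formula A ℓ}
    (hΞ : ∀ ξ ∈ Ξ, Provable Γ ξ) (h : ∀ v, IsValuation v → (∀ ξ ∈ Ξ, v ξ) → v φ) :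
    Provable Γ φ := by
  obtain ⟨l, hl, hl'⟩ := exists_list_of_entails Ξ φ h
  exact of_imp (fun v hv hc => hl' v hv ((hv.conj l).1 hc)) (conj fun ψ hψ => hΞ ψ (hl ψ hψ))

end Provable

/-! ### Complete and saturated theories -/

/-- Complete theories of the finitary part of the logic: the points of the Stone space of its
Lindenbaum algebra. -/
structure IsComplete (Γ : Set (Formula A ℓ)) : Prop where
  isValuation : IsValuation (· ∈ Γ)
  theorem_mem : ∀ φ, Provable ∅ φ → φ ∈ Γ

theorem IsComplete.of_imp {Γ : Set (Formula A ℓ)} (h : IsComplete Γ) {φ ψ : Formula A ℓ}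
    (hp : Provable ∅ (imp φ ψ)) (hφ : φ ∈ Γ) : ψ ∈ Γ :=
  (h.isValuation.imp φ ψ).1 (h.theorem_mem _ hp) hφ

/-- A valuation that makes all theorems true is the same thing as a complete theory, so
propositional compactness suffices. -/
theorem provable_of_forall_isComplete {φ : Formula A ℓ}
    (h : ∀ Γ : Set (Formula A ℓ), IsComplete Γ → φ ∈ Γ) : Provable ∅ φ :=
  Provable.of_entails (Ξ := {ξ | Provable ∅ ξ}) (fun _ hξ => hξ)
    fun v hv hvΞ => h {ψ | v ψ} ⟨hv, hvΞ⟩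

/-- Compactness of truth sets in the Stone space, in the form needed for σ-subadditivity. -/
theorem exists_lt_of_forall_isComplete {φ : Formula A ℓ} {f : ℕ → Formula A ℓ}
    (h : ∀ Γ : Set (Formula A ℓ), IsComplete Γ → φ ∈ Γ → ∃ i, f i ∈ Γ) :
    ∃ N, ∀ Γ : Set (Formula A ℓ), IsComplete Γ → φ ∈ Γ → ∃ i < N, f i ∈ Γ := by
  obtain ⟨l, hl, hl'⟩ := exists_list_of_entails
    ({ξ | Provable ∅ ξ} ∪ {φ} ∪ Set.range fun i => neg (f i)) bot (by
      intro v hv hΞ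
      obtain ⟨i, hi⟩ := h {ψ | v ψ} ⟨hv, fun ξ hξ => hΞ ξ (.inl (.inl hξ))⟩
        (hΞ φ (.inl (.inr rfl)))
      exact absurd hi ((hv.neg _).1 (hΞ _ (.inr ⟨i, rfl⟩))))
  have hN : ∃ N, ∀ ξ ∈ l, Provable ∅ ξ ∨ ξ = φ ∨ ∃ i < N, ξ = neg (f i) := by
    clear hl'
    induction l with
    | nil => exact ⟨0, by simp⟩
    | cons χ l ih =>
      obtain ⟨N, hN⟩ := ih fun ξ hξ => hl ξ (by simp [hξ])
      have : ∃ M, Provable ∅ χ ∨ χ = φ ∨ ∃ i < M, χ = neg (f i) := by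
        rcases hl χ (by simp) with (hχ | hχ) | ⟨i, rfl⟩
        · exact ⟨0, .inl hχ⟩
        · exact ⟨0, .inr (.inl hχ)⟩
        · exact ⟨i + 1, .inr (.inr ⟨i, i.lt_succ_self, rfl⟩)⟩
      obtain ⟨M, hM⟩ := this
      refine ⟨max M N, fun ξ hξ => ?_⟩
      rcases List.mem_cons.1 hξ with rfl | hξ
      · exact hM.imp_right (Or.imp_right fun ⟨i, hi, e⟩ => ⟨i, lt_max_of_lt_left hi, e⟩)
      · exact (hN ξ hξ).imp_right (Or.imp_right fun ⟨i, hi, e⟩ => ⟨i, lt_max_of_lt_right hi, e⟩)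
  obtain ⟨N, hN⟩ := hN
  refine ⟨N, fun Γ hΓ hφ => ?_⟩
  by_contra! hcon
  refine hΓ.isValuation.not_bot (hl' _ hΓ.isValuation fun ξ hξ => ?_)
  rcases hN ξ hξ with h1 | rfl | ⟨i, hi, rfl⟩
  · exact hΓ.theorem_mem _ h1
  · exact hφ
  · exact (hΓ.isValuation.neg _).2 (hcon i hi)

/-- The infinitary rules for the operators, as pairs of a set of premises and a conclusion. -/
inductive IsBaseRule : Set (Formula A ℓ) × Formula A ℓ → Prop
  | atLeast_of_lt (a s φ) : IsBaseRule ({χ | ∃ r < s, χ = atLeast a r φ}, atLeast a s φ)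
  | bot_of_gt (a s φ) : IsBaseRule ({χ | ∃ r > s, χ = atLeast a r φ}, bot)
  | atMost_of_gt (h : ℓ = CML.full) (a s φ) :
      IsBaseRule ({χ | ∃ r > s, χ = atMost h a r φ}, atMost h a s φ)

/-- The instance of the countable additivity rule that is obtained from a rule by moving its
conclusion, negated, to the premises. -/
def ruleStep (p : A × ℚ≥0) (ρ : Set (Formula A ℓ) × Formula A ℓ) :
    Set (Formula A ℓ) × Formula A ℓ :=
  ({χ | ∃ ψ ∈ conjunctions (insert (neg ρ.2) ρ.1), χ = atLeast p.1 p.2 ψ}, atLeast p.1 p.2 bot)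

/-- A countable set of infinitary rules, closed under `ruleStep`, that generates the logic over
its theorems. -/
def coreRules (A : Type*) (ℓ : CML) : Set (Set (Formula A ℓ) × Formula A ℓ) :=
  ⋃ l : List (A × ℚ≥0), (fun ρ => l.foldr ruleStep ρ) '' {ρ | IsBaseRule ρ}

theorem countable_coreRules [Countable A] : (coreRules A ℓ).Countable := by
  refine Set.countable_iUnion fun l => Set.Countable.image ?_ _
  have : {ρ : Set (Formula A ℓ) × Formula A ℓ | IsBaseRule ρ} ⊆
      Set.range (fun p : A × ℚ≥0 × Formula A ℓ =>
        ({χ | ∃ r < p.2.1, χ = atLeast p.1 r p.2.2}, atLeast p.1 p.2.1 p.2.2)) ∪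
      Set.range (fun p : A × ℚ≥0 × Formula A ℓ =>
        ({χ | ∃ r > p.2.1, χ = atLeast p.1 r p.2.2}, bot)) ∪
      ⋃ h : ℓ = CML.full, Set.range (fun p : A × ℚ≥0 × Formula A ℓ =>
        ({χ | ∃ r > p.2.1, χ = atMost h p.1 r p.2.2}, atMost h p.1 p.2.1 p.2.2)) := by
    rintro _ (⟨a, s, φ⟩ | ⟨a, s, φ⟩ | ⟨h, a, s, φ⟩)
    · exact .inl (.inl ⟨(a, s, φ), rfl⟩)
    · exact .inl (.inr ⟨(a, s, φ), rfl⟩)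
    · exact .inr (Set.mem_iUnion.2 ⟨h, (a, s, φ), rfl⟩)
  exact Set.Countable.mono this (((Set.countable_range _).union (Set.countable_range _)).union
    (Set.countable_iUnion fun h => Set.countable_range _))

theorem IsBaseRule.mem_coreRules {ρ : Set (Formula A ℓ) × Formula A ℓ} (h : IsBaseRule ρ) :
    ρ ∈ coreRules A ℓ :=
  Set.mem_iUnion.2 ⟨[], ρ, h, rfl⟩

theorem ruleStep_mem_coreRules {ρ : Set (Formula A ℓ) × Formula A ℓ} (h : ρ ∈ coreRules A ℓ)
    (p : A × ℚ≥0) : ruleStep p ρ ∈ coreRules A ℓ := by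
  obtain ⟨l, ρ', h', rfl⟩ := Set.mem_iUnion.1 h
  exact Set.mem_iUnion.2 ⟨p :: l, ρ', h', rfl⟩

theorem provable_of_mem_coreRules {ρ : Set (Formula A ℓ) × Formula A ℓ} (h : ρ ∈ coreRules A ℓ) :
    Provable ρ.1 ρ.2 := by
  obtain ⟨l, ρ, hb, rfl⟩ := Set.mem_iUnion.1 h
  clear h
  induction l with
  | nil =>
    rcases (id hb : IsBaseRule ρ) with ⟨a, s, φ⟩ | ⟨a, s, φ⟩ | ⟨h, a, s, φ⟩
    · exact .atLeast_of_lt a s φ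
    · exact .bot_of_gt a s φ
    · exact .atMost_of_gt h a s φ
  -- Premises together with the negated conclusion of a derivable rule prove `bot`; countable
  -- additivity applies to this derivation.
  | cons p l ih =>
    refine .car p.1 p.2 ?_
    refine Provable.of_entails (Ξ := {(l.foldr ruleStep ρ).2, neg (l.foldr ruleStep ρ).2}) ?_ ?_
    · rintro ξ (rfl | rfl)
      · exact ih.mono (Set.subset_insert _ _)
      · exact .hyp (Set.mem_insert _ _)
    · intro v hv h
      exact absurd (h _ (.inl rfl)) ((hv.neg _).1 (h _ (.inr rfl)))

/-- Complete theories that are closed under the core rules. -/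
structure IsSaturated (Γ : Set (Formula A ℓ)) : Prop extends IsComplete Γ where
  rule : ∀ ρ ∈ coreRules A ℓ, ρ.1 ⊆ Γ → ρ.2 ∈ Γ

theorem MaxConsistent.mem_of_provable {Γ : Set (Formula A ℓ)} (h : MaxConsistent Γ)
    {φ : Formula A ℓ} (hφ : Provable Γ φ) : φ ∈ Γ := by
  by_contra hn
  exact h.1 (.modusPonens (.deduction (not_not.1 (h.2 φ hn))) hφ)

theorem MaxConsistent.isSaturated {Γ : Set (Formula A ℓ)} (h : MaxConsistent Γ) :
    IsSaturated Γ where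
  isValuation := by
    refine ⟨h.mem_of_provable (.of_valuation fun v hv => hv.top), fun ψ => ⟨fun h1 h2 => ?_,
      fun h1 => ?_⟩, fun ψ χ => ⟨fun h1 => ⟨?_, ?_⟩, fun h1 => ?_⟩⟩
    · refine h.1 (.of_entails (Ξ := {ψ, neg ψ}) ?_ ?_)
      · rintro ξ (rfl | rfl)
        exacts [.hyp h2, .hyp h1]
      · intro v hv h
        exact absurd (h _ (.inl rfl)) ((hv.neg _).1 (h _ (.inr rfl)))
    · refine h.mem_of_provable (.of_imp (fun v hv h' => ?_) (.deduction (not_not.1 (h.2 ψ h1))))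
      rw [hv.imp] at h'
      exact (hv.neg _).2 fun h'' => hv.not_bot (h' h'')
    · exact h.mem_of_provable (.of_imp (fun v hv h' => ((hv.and _ _).1 h').1) (.hyp h1))
    · exact h.mem_of_provable (.of_imp (fun v hv h' => ((hv.and _ _).1 h').2) (.hyp h1))
    · exact h.mem_of_provable (.and (.hyp h1.1) (.hyp h1.2))
  theorem_mem φ hφ := h.mem_of_provable (hφ.mono (Set.empty_subset _))
  rule ρ hρ hsub := h.mem_of_provable ((provable_of_mem_coreRules hρ).mono hsub)

/-! ### Canonical rates -/

/-- The supremum of the rates that a theory guarantees. -/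
noncomputable def rateSup (Γ : Set (Formula A ℓ)) (a : A) (φ : Formula A ℓ) : ℝ≥0∞ :=
  ⨆ (r : ℚ≥0) (_ : atLeast a r φ ∈ Γ), ((r : ℝ≥0) : ℝ≥0∞)

theorem le_rateSup {Γ : Set (Formula A ℓ)} {a : A} {φ : Formula A ℓ} {r : ℚ≥0}
    (h : atLeast a r φ ∈ Γ) : ((r : ℝ≥0) : ℝ≥0∞) ≤ rateSup Γ a φ :=
  le_iSup₂_of_le r h le_rfl

section

variable {Γ : Set (Formula A ℓ)} {a : A} {φ ψ : Formula A ℓ} {r s : ℚ≥0}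

theorem IsComplete.atLeast_anti (h : IsComplete Γ) (hrs : r ≤ s) (hs : atLeast a s φ ∈ Γ) :
    atLeast a r φ ∈ Γ := by
  rcases hrs.eq_or_lt with rfl | hlt
  · exact hs
  obtain ⟨t, rfl⟩ := exists_add_of_le hrs
  have ht : 0 < t := by simpa using hlt
  cases ℓ with
  | base => exact h.of_imp (.atLeast_le a r t φ rfl) hs
  | full =>
    -- The full logic has no monotonicity axiom in the rate; it follows by playing the two axioms
    -- linking `atLeast` and `atMost` against each other.
    by_contra hn
    have h1 := h.of_imp (.not_atMost_of_atLeast rfl a r t φ ht) hs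
    have h2 := h.of_imp (.atMost_of_not_atLeast rfl a r φ) ((h.isValuation.neg _).2 hn)
    exact (h.isValuation.neg _).1 h1 h2

theorem IsComplete.atLeast_mem_of_lt (h : IsComplete Γ)
    (hr : ((r : ℝ≥0) : ℝ≥0∞) < rateSup Γ a φ) : atLeast a r φ ∈ Γ := by
  obtain ⟨s, hs⟩ := lt_iSup_iff.1 hr
  obtain ⟨hs, hlt⟩ := lt_iSup_iff.1 hs
  exact h.atLeast_anti (ENNReal.coe_nnrat_lt_coe.1 hlt).le hs

theorem IsComplete.rateSup_le (h : IsComplete Γ) (hr : atLeast a r φ ∉ Γ) :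
    rateSup Γ a φ ≤ ((r : ℝ≥0) : ℝ≥0∞) :=
  not_lt.1 fun hlt => hr (h.atLeast_mem_of_lt hlt)

theorem IsComplete.rateSup_mono (h : IsComplete Γ) (hp : Provable ∅ (imp φ ψ)) :
    rateSup Γ a φ ≤ rateSup Γ a ψ :=
  iSup₂_le fun _ hr => le_rateSup (h.of_imp (.atLeast_mono a _ hp) hr)

/-- Completeness alone decides rates strictly below the supremum; the rule `atLeast_of_lt` makes the
supremum attained when it is rational. -/
theorem IsSaturated.atLeast_mem_iff (h : IsSaturated Γ) :
    atLeast a r φ ∈ Γ ↔ ((r : ℝ≥0) : ℝ≥0∞) ≤ rateSup Γ a φ := by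
  refine ⟨le_rateSup, fun hr => ?_⟩
  refine h.rule _ (IsBaseRule.atLeast_of_lt a r φ).mem_coreRules ?_
  rintro _ ⟨s, hs, rfl⟩
  exact h.atLeast_mem_of_lt ((ENNReal.coe_nnrat_lt_coe.2 hs).trans_le hr)

theorem IsSaturated.rateSup_ne_top (h : IsSaturated Γ) : rateSup Γ a φ ≠ ∞ := by
  intro htop
  refine h.isValuation.not_bot (h.rule _ (IsBaseRule.bot_of_gt a 0 φ).mem_coreRules ?_)
  rintro _ ⟨s, -, rfl⟩
  exact h.atLeast_mem_of_lt (htop ▸ ENNReal.coe_lt_top)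

theorem IsSaturated.atMost_mem_iff (h : IsSaturated Γ) (hℓ : ℓ = CML.full) :
    atMost hℓ a r φ ∈ Γ ↔ rateSup Γ a φ ≤ ((r : ℝ≥0) : ℝ≥0∞) := by
  refine ⟨fun hr => ?_, fun hr => ?_⟩
  · by_contra! hlt
    obtain ⟨t, hrt, ht⟩ := ENNReal.exists_nnrat_btwn hlt
    rw [ENNReal.coe_nnrat_lt_coe] at hrt
    obtain ⟨u, rfl⟩ := exists_add_of_le hrt.le
    have hu : 0 < u := by simpa using hrt
    exact (h.isValuation.neg _).1
      (h.of_imp (.not_atMost_of_atLeast hℓ a r u φ hu) (h.atLeast_mem_of_lt ht)) hr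
  · refine h.rule _ (IsBaseRule.atMost_of_gt hℓ a r φ).mem_coreRules ?_
    rintro _ ⟨s, hs, rfl⟩
    refine h.of_imp (.atMost_of_not_atLeast hℓ a s φ) ((h.isValuation.neg _).2 fun hmem => ?_)
    exact ((ENNReal.coe_nnrat_lt_coe.2 hs).trans_le (le_rateSup hmem)).not_ge hr

/-- Superadditivity comes from `atLeast_add` in the base logic and from `not_atMost_add` in the full
one; subadditivity comes from `not_atLeast_add` in both. -/
theorem IsSaturated.rateSup_add (h : IsSaturated Γ) (a : A) (φ ψ : Formula A ℓ) :
    rateSup Γ a (and φ ψ) + rateSup Γ a (and φ (neg ψ)) = rateSup Γ a φ := by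
  refine le_antisymm ?_ ?_
  · have hmono : ∀ χ : Formula A ℓ, rateSup Γ a (and φ χ) ≤ rateSup Γ a φ := fun χ =>
      h.rateSup_mono (.of_valuation fun v hv => by rw [hv.imp, hv.and]; exact And.left)
    refine ENNReal.add_le_of_forall_nnrat (hmono _) (hmono _) fun r s hr hs => le_rateSup ?_
    cases ℓ with
    | base =>
      exact h.of_imp (.atLeast_add a r s φ ψ rfl) ((h.isValuation.and _ _).2
        ⟨h.atLeast_mem_of_lt hr, h.atLeast_mem_of_lt hs⟩)
    | full =>
      have h1 := h.of_imp (.not_atMost_add rfl a r s φ ψ) ((h.isValuation.and _ _).2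
        ⟨(h.isValuation.neg _).2 fun hm => ((h.atMost_mem_iff rfl).1 hm).not_gt hr,
          (h.isValuation.neg _).2 fun hm => ((h.atMost_mem_iff rfl).1 hm).not_gt hs⟩)
      by_contra hn
      exact (h.isValuation.neg _).1 h1
        (h.of_imp (.atMost_of_not_atLeast rfl a _ φ) ((h.isValuation.neg _).2 hn))
  · refine ENNReal.le_add_of_forall_nnrat h.rateSup_ne_top h.rateSup_ne_top fun r s hr hs =>
      h.rateSup_le ((h.isValuation.neg _).1 ?_)
    refine h.of_imp (.not_atLeast_add a r s φ ψ) ((h.isValuation.and _ _).2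
      ⟨(h.isValuation.neg _).2 fun hm => ?_, (h.isValuation.neg _).2 fun hm => ?_⟩)
    · exact (le_rateSup hm).not_gt hr
    · exact (le_rateSup hm).not_gt hs

/-- Splitting `bot` along `top` gives two parts, each of rate at least that of `bot`. A finite `c`
with `c + c ≤ c` is zero. -/
theorem IsSaturated.rateSup_bot (h : IsSaturated Γ) : rateSup Γ a bot = 0 := by
  have hle : ∀ χ : Formula A ℓ, rateSup Γ a bot ≤ rateSup Γ a χ := fun χ =>
    h.rateSup_mono (.of_valuation fun v hv => (hv.imp _ _).2 fun hb => absurd hb hv.not_bot)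
  have h1 := h.rateSup_add a bot top
  have h2 : rateSup Γ a bot + rateSup Γ a bot ≤ rateSup Γ a bot + 0 := by
    rw [add_zero]; exact (add_le_add (hle _) (hle _)).trans h1.le
  exact nonpos_iff_eq_zero.1 ((ENNReal.add_le_add_iff_left h.rateSup_ne_top).1 h2)

end

end Formula

open Formula

/-! ### Spaces of theories -/

/-- The space of the sets of formulas with the property `P`. -/
def TheorySpace {A : Type*} {ℓ : CML} (P : Set (Formula A ℓ) → Prop) : Type _ := {Φ // P Φ}

namespace TheorySpace

variable {A : Type*} {ℓ : CML} {P : Set (Formula A ℓ) → Prop}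

/-- The theories in the space that contain `φ`. -/
def basic (P : Set (Formula A ℓ) → Prop) (φ : Formula A ℓ) : Set (TheorySpace P) :=
  {Φ | φ ∈ Φ.1}

instance : MeasurableSpace (TheorySpace P) :=
  MeasurableSpace.generateFrom (Set.range (basic P))

theorem measurableSet_basic (φ : Formula A ℓ) : MeasurableSet (basic P φ) :=
  MeasurableSpace.measurableSet_generateFrom ⟨φ, rfl⟩

/-- The inclusion of the space into the space of all sets of formulas. -/
def toSet (Φ : TheorySpace P) : Set (Formula A ℓ) := Φ.1

theorem measurable_toSet : Measurable (toSet (P := P)) :=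
  measurable_set_iff.2 fun φ => measurableSet_setOfPred.1 (measurableSet_basic φ)

theorem measurable_of_mem {X : Type*} [MeasurableSpace X] {f : X → TheorySpace P}
    (h : ∀ φ, MeasurableSet {x | φ ∈ (f x).1}) : Measurable f := by
  refine measurable_generateFrom ?_
  rintro _ ⟨φ, rfl⟩
  exact h φ

theorem comap_toSet_eq :
    MeasurableSpace.comap (toSet (P := P)) inferInstance =
      (inferInstance : MeasurableSpace (TheorySpace P)) := by
  refine le_antisymm (measurable_iff_comap_le.1 measurable_toSet) ?_
  refine MeasurableSpace.generateFrom_le ?_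
  rintro _ ⟨φ, rfl⟩
  exact ⟨{Φ | φ ∈ Φ}, measurableSet_mem φ, rfl⟩

theorem measurableEmbedding_toSet (hP : MeasurableSet {Φ | P Φ}) :
    MeasurableEmbedding (toSet (P := P)) := by
  refine ⟨Subtype.val_injective, measurable_toSet, fun s hs => ?_⟩
  obtain ⟨t, ht, rfl⟩ : MeasurableSet[MeasurableSpace.comap toSet inferInstance] s := by
    rwa [comap_toSet_eq]
  have : toSet '' (toSet ⁻¹' t : Set (TheorySpace P)) = t ∩ {Φ | P Φ} := by
    ext Φ
    constructor
    · rintro ⟨Ψ, hΨ, rfl⟩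
      exact ⟨hΨ, Ψ.2⟩
    · rintro ⟨h1, h2⟩
      exact ⟨⟨Φ, h2⟩, h1, rfl⟩
  rw [this]
  exact ht.inter hP

/-- With countably many formulas, the sets of formulas form a standard Borel space. A measurable
subset carries a Polish topology with the same Borel sets, which is pulled back along the inclusion.
-/
theorem isAnalyticMeasurableSpace [Countable A] (hP : MeasurableSet {Φ | P Φ}) :
    IsAnalyticMeasurableSpace (TheorySpace P) := by
  have : StandardBorelSpace (Set (Formula A ℓ)) :=
    inferInstanceAs (StandardBorelSpace (Formula A ℓ → Prop))
  have hemb := measurableEmbedding_toSet hP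
  obtain ⟨τ, hb, hp⟩ := hemb.measurableSet_range.standardBorel.polish
  let e := hemb.equivRange
  refine ⟨τ.induced e, ⟨Set.range (toSet (P := P)), τ, hp, e,
    letI := τ.induced e; ⟨⟨rfl⟩, e.injective⟩, ?_⟩, ?_⟩
  · rw [e.surjective.range_eq]
    exact MeasurableSet.univ.analyticSet
  · refine @BorelSpace.mk _ (τ.induced e) _ ?_
    refine e.measurableEmbedding.comap_eq.symm.trans ?_
    exact (congrArg (MeasurableSpace.comap e) hb.measurable_eq).trans borel_comap.symm

theorem isPiSystem_basic (hP : ∀ Φ, P Φ → IsComplete Φ) : IsPiSystem (Set.range (basic P)) := by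
  rintro _ ⟨φ, rfl⟩ _ ⟨ψ, rfl⟩ -
  exact ⟨and φ ψ, Set.ext fun Φ => (hP _ Φ.2).isValuation.and φ ψ⟩

theorem basic_top (hP : ∀ Φ, P Φ → IsComplete Φ) : basic P top = Set.univ :=
  Set.eq_univ_of_forall fun Φ => (hP _ Φ.2).isValuation.top

/-- A finite measure on a space of complete theories is determined by its values on formulas. -/
theorem measure_ext (hP : ∀ Φ, P Φ → IsComplete Φ) {μ ν : Measure (TheorySpace P)}
    [IsFiniteMeasure μ] (h : ∀ φ, μ (basic P φ) = ν (basic P φ)) : μ = ν := by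
  refine ext_of_generate_finite _ rfl (isPiSystem_basic hP) ?_ ?_
  · rintro _ ⟨φ, rfl⟩
    exact h φ
  · rw [← basic_top hP]
    exact h top

end TheorySpace

namespace Formula

variable {A : Type*} {ℓ : CML}

open TheorySpace

/-- Only countably many conditions occur, each on countably many membership statements; this is why
closure is demanded under `coreRules` and not under all derivations. -/
theorem measurableSet_isSaturated [Countable A] :
    MeasurableSet {Γ : Set (Formula A ℓ) | IsSaturated Γ} := by
  have : {Γ : Set (Formula A ℓ) | IsSaturated Γ} =
      {Γ | top ∈ Γ} ∩ {Γ | ∀ ψ, neg ψ ∈ Γ ↔ ¬ ψ ∈ Γ} ∩ {Γ | ∀ ψ χ, and ψ χ ∈ Γ ↔ ψ ∈ Γ ∧ χ ∈ Γ} ∩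
      {Γ | ∀ φ, Provable ∅ φ → φ ∈ Γ} ∩
      {Γ | ∀ ρ ∈ coreRules A ℓ, (∀ ψ, ψ ∈ ρ.1 → ψ ∈ Γ) → ρ.2 ∈ Γ} := by
    ext Γ
    exact ⟨fun h => ⟨⟨⟨⟨h.isValuation.top, h.isValuation.neg⟩, h.isValuation.and⟩, h.theorem_mem⟩,
      h.rule⟩, fun ⟨⟨⟨⟨h1, h2⟩, h3⟩, h4⟩, h5⟩ => ⟨⟨⟨h1, h2, h3⟩, h4⟩, h5⟩⟩
  rw [this]
  refine ((((measurableSet_mem _).inter ?_).inter ?_).inter ?_).inter ?_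
  · exact measurableSet_setOfPred.2 <| .forall fun ψ =>
      (measurable_set_mem _).iff (measurable_set_mem _).not
  · exact measurableSet_setOfPred.2 <| .forall fun ψ => .forall fun χ =>
      (measurable_set_mem _).iff ((measurable_set_mem _).and (measurable_set_mem _))
  · exact measurableSet_setOfPred.2 <| .forall fun ψ => measurable_const.imp (measurable_set_mem _)
  · rw [Set.ofPred_forall]
    simp_rw [Set.ofPred_forall]
    exact .biInter countable_coreRules fun ρ _ => measurableSet_setOfPred.2 <|
      .imp (.forall fun ψ => measurable_const.imp (measurable_set_mem _)) (measurable_set_mem _)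

/-! ### Measures on the Stone space and the canonical kernel -/

/-- The truth sets in the Stone space. -/
def stoneSets (A : Type*) (ℓ : CML) : Set (Set (TheorySpace (IsComplete (A := A) (ℓ := ℓ)))) :=
  Set.range (basic IsComplete)

theorem basic_bot : basic (IsComplete (A := A) (ℓ := ℓ)) bot = ∅ :=
  Set.eq_empty_of_forall_notMem fun Φ h => Φ.2.isValuation.not_bot h

theorem basic_union (φ ψ : Formula A ℓ) :
    basic IsComplete φ ∪ basic IsComplete ψ = basic IsComplete (neg (and (neg φ) (neg ψ))) := by
  ext Φ
  simp only [basic, Set.mem_union, Set.mem_ofPred_eq, Φ.2.isValuation.neg, Φ.2.isValuation.and]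
  tauto

theorem basic_sdiff (φ ψ : Formula A ℓ) :
    basic IsComplete φ \ basic IsComplete ψ = basic IsComplete (and φ (neg ψ)) := by
  ext Φ
  simp only [basic, Set.mem_sdiff, Set.mem_ofPred_eq, Φ.2.isValuation.neg, Φ.2.isValuation.and]

theorem isSetRing_stoneSets : IsSetRing (stoneSets A ℓ) where
  empty_mem := ⟨bot, basic_bot⟩
  union_mem := by
    rintro _ _ ⟨φ, rfl⟩ ⟨ψ, rfl⟩
    exact ⟨_, (basic_union φ ψ).symm⟩
  sdiff_mem := by
    rintro _ _ ⟨φ, rfl⟩ ⟨ψ, rfl⟩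
    exact ⟨_, (basic_sdiff φ ψ).symm⟩

theorem provable_of_basic_subset {φ ψ : Formula A ℓ}
    (h : basic IsComplete φ ⊆ basic IsComplete ψ) : Provable ∅ (imp φ ψ) :=
  provable_of_forall_isComplete fun Γ hΓ => (hΓ.isValuation.imp φ ψ).2 fun hφ =>
    h (a := ⟨Γ, hΓ⟩) hφ

/-- The canonical rate as a function on truth sets. -/
noncomputable def stoneRate (Γ : Set (Formula A ℓ)) (a : A) :
    Set (TheorySpace (IsComplete (A := A) (ℓ := ℓ))) → ℝ≥0∞ :=
  Function.extend (basic IsComplete) (rateSup Γ a) 0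

namespace IsSaturated

variable {Γ : Set (Formula A ℓ)}

/-- Formulas with equal truth sets are provably equivalent, so the rate is well defined on truth
sets. -/
theorem rateSup_congr (h : IsComplete Γ) (a : A) {φ ψ : Formula A ℓ}
    (hb : basic IsComplete φ = basic IsComplete ψ) : rateSup Γ a φ = rateSup Γ a ψ :=
  le_antisymm (h.rateSup_mono (provable_of_basic_subset hb.le))
    (h.rateSup_mono (provable_of_basic_subset hb.ge))

theorem stoneRate_basic (h : IsComplete Γ) (a : A) (φ : Formula A ℓ) :
    stoneRate Γ a (basic IsComplete φ) = rateSup Γ a φ :=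
  Function.FactorsThrough.extend_apply (fun _ _ hb => rateSup_congr h a hb) _ _

/-- The canonical rate as a content on the truth sets. -/
noncomputable def stoneContent (h : IsSaturated Γ) (a : A) :
    AddContent ℝ≥0∞ (stoneSets A ℓ) :=
  isSetRing_stoneSets.addContent_of_union (stoneRate Γ a)
    (by rw [← basic_bot, stoneRate_basic h.toIsComplete, h.rateSup_bot]) (by
      rintro _ _ ⟨φ, rfl⟩ ⟨ψ, rfl⟩ hd
      have h1 : ∀ Φ : TheorySpace (IsComplete (A := A) (ℓ := ℓ)), φ ∈ Φ.1 → ψ ∉ Φ.1 :=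
        fun Φ h1 h2 => Set.disjoint_left.1 hd h1 h2
      rw [basic_union]
      simp only [stoneRate_basic h.toIsComplete]
      rw [← h.rateSup_add a _ φ]
      congr 1 <;> refine rateSup_congr h.toIsComplete a (Set.ext fun Φ => ?_) <;>
      · have := h1 Φ
        simp only [basic, Set.mem_ofPred_eq, Φ.2.isValuation.neg, Φ.2.isValuation.and]
        tauto)

theorem stoneContent_basic (h : IsSaturated Γ) (a : A) (φ : Formula A ℓ) :
    h.stoneContent a (basic IsComplete φ) = rateSup Γ a φ :=
  stoneRate_basic h.toIsComplete a φ

/-- A countable union of truth sets that is itself a truth set is covered by finitely many of them,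
so finite subadditivity is enough. -/
theorem isSigmaSubadditive_stoneContent (h : IsSaturated Γ) (a : A) :
    (h.stoneContent a).IsSigmaSubadditive := by
  rintro f hf ⟨φ, hφ⟩
  choose g hg using hf
  obtain ⟨N, hN⟩ := exists_lt_of_forall_isComplete (φ := φ) (f := g) fun Δ hΔ hmem => by
    have : (⟨Δ, hΔ⟩ : TheorySpace IsComplete) ∈ ⋃ i, f i := hφ ▸ hmem
    obtain ⟨i, hi⟩ := Set.mem_iUnion.1 this
    rw [← hg i] at hi
    exact ⟨i, hi⟩
  have hC := isSetRing_stoneSets (A := A) (ℓ := ℓ)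
  have hfC : ∀ i, f i ∈ stoneSets A ℓ := fun i => ⟨g i, hg i⟩
  have hsub : ⋃ i, f i ⊆ ⋃ i ∈ Finset.range N, f i := by
    rw [← hφ]
    intro Φ hΦ
    obtain ⟨i, hi, hmem⟩ := hN Φ.1 Φ.2 hΦ
    refine Set.mem_biUnion (x := i) (by simpa using hi) ?_
    rw [← hg i]
    exact hmem
  have hmem : ⋃ i ∈ Finset.range N, f i ∈ stoneSets A ℓ :=
    hC.biUnion_mem _ fun i _ => hfC i
  calc _ ≤ h.stoneContent a (⋃ i ∈ Finset.range N, f i) :=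
        addContent_mono hC.isSetSemiring ⟨φ, hφ⟩ hmem hsub
    _ ≤ ∑ i ∈ Finset.range N, h.stoneContent a (f i) :=
        addContent_biUnion_le hC fun i _ => hfC i
    _ ≤ _ := ENNReal.sum_le_tsum _

/-- The measure on the Stone space with the canonical rates. -/
noncomputable def stoneMeasure (h : IsSaturated Γ) (a : A) :
    Measure (TheorySpace (IsComplete (A := A) (ℓ := ℓ))) :=
  (h.stoneContent a).measure isSetRing_stoneSets.isSetSemiring le_rfl
    (h.isSigmaSubadditive_stoneContent a)

theorem stoneMeasure_basic (h : IsSaturated Γ) (a : A) (φ : Formula A ℓ) :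
    h.stoneMeasure a (basic IsComplete φ) = rateSup Γ a φ :=
  ((h.stoneContent a).measure_eq isSetRing_stoneSets.isSetSemiring rfl
    (h.isSigmaSubadditive_stoneContent a) ⟨φ, rfl⟩).trans (h.stoneContent_basic a φ)

/-- The theories that violate a core rule form a null set. -/
theorem stoneMeasure_rule (h : IsSaturated Γ) (a : A) {ρ : Set (Formula A ℓ) × Formula A ℓ}
    (hρ : ρ ∈ coreRules A ℓ) :
    h.stoneMeasure a {Δ | ρ.1 ⊆ Δ.1 ∧ ρ.2 ∉ Δ.1} = 0 := by
  by_contra hne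
  obtain ⟨r, hr, hr'⟩ := ENNReal.exists_nnrat_btwn (pos_iff_ne_zero.2 hne)
  -- The violating set lies in the truth set of every finite conjunction of premises and negated
  -- conclusion, so each conjunction has rate at least `r`.
  have hmem := h.rule _ (ruleStep_mem_coreRules hρ (a, r)) (by
    rintro _ ⟨_, ⟨l, hl, rfl⟩, rfl⟩
    rw [h.atLeast_mem_iff, ← h.stoneMeasure_basic]
    refine hr'.le.trans (measure_mono fun Δ hΔ => (Δ.2.isValuation.conj l).2 fun ψ hψ => ?_)
    rcases hl ψ hψ with rfl | hψ
    · exact (Δ.2.isValuation.neg _).2 hΔ.2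
    · exact hΔ.1 hψ)
  have := h.atLeast_mem_iff.1 hmem
  rw [h.rateSup_bot] at this
  exact this.not_gt hr

theorem stoneMeasure_not_isSaturated [Countable A] (h : IsSaturated Γ) (a : A) :
    h.stoneMeasure a {Δ | ¬ IsSaturated Δ.1} = 0 := by
  refine measure_mono_null ?_ ((measure_biUnion_null_iff countable_coreRules).2
    fun ρ hρ => h.stoneMeasure_rule a hρ)
  intro Δ hΔ
  by_contra hcon
  refine hΔ ⟨Δ.2, fun ρ hρ hsub => ?_⟩
  by_contra hn
  exact hcon (Set.mem_biUnion hρ ⟨hsub, hn⟩)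

end IsSaturated

/-- The rate is a countable supremum of constants times indicators of measurable sets. -/
theorem measurable_rateSup {X : Type*} [MeasurableSpace X] {f : X → Set (Formula A ℓ)}
    (hf : ∀ φ, MeasurableSet {x | φ ∈ f x}) (a : A) (φ : Formula A ℓ) :
    Measurable fun x => rateSup (f x) a φ := by
  classical
  refine Measurable.iSup fun r => ?_
  have : (fun x => ⨆ _ : atLeast a r φ ∈ f x, ((r : ℝ≥0) : ℝ≥0∞)) =
      Set.indicator {x | atLeast a r φ ∈ f x} fun _ => ((r : ℝ≥0) : ℝ≥0∞) := by
    ext x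
    by_cases hx : atLeast a r φ ∈ f x <;> simp [hx]
  rw [this]
  exact measurable_const.indicator (hf _)

/-- Existence of a Markov kernel with the canonical rates. -/
theorem exists_cmk_rate_eq_rateSup [Countable A] {P : Set (Formula A ℓ) → Prop}
    (hP : ∀ Φ, P Φ ↔ IsSaturated Φ) :
    ∃ K : CMK A (TheorySpace P), ∀ a Φ φ, K.rate a Φ (basic P φ) = rateSup Φ.1 a φ := by
  have hcomp : ∀ Φ, P Φ → IsComplete Φ := fun Φ h => ((hP Φ).1 h).toIsComplete
  have hmeas : MeasurableSet {Φ | P Φ} := by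
    simp_rw [hP]
    exact measurableSet_isSaturated
  -- Complete theories and theories with `P` are compared inside the space of all sets of formulas:
  -- push the Stone measure forward, then restrict it.
  let κ (a : A) (Φ : TheorySpace P) : Measure (TheorySpace P) :=
    ((((hP _).1 Φ.2).stoneMeasure a).map toSet).comap toSet
  have hκ : ∀ a Φ φ, κ a Φ (basic P φ) = rateSup Φ.1 a φ := by
    intro a Φ φ
    have h := (hP _).1 Φ.2
    simp only [κ]
    have he : toSet '' basic P φ = {Ψ | φ ∈ Ψ} ∩ {Ψ | P Ψ} := by
      ext Ψ
      constructor
      · rintro ⟨Ψ, hΨ, rfl⟩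
        exact ⟨hΨ, Ψ.2⟩
      · rintro ⟨h1, h2⟩
        exact ⟨⟨Ψ, h2⟩, h1, rfl⟩
    rw [(measurableEmbedding_toSet hmeas).comap_apply, he,
      Measure.map_apply measurable_toSet ((measurableSet_mem φ).inter hmeas), Set.preimage_inter,
      measure_inter_conull, ← h.stoneMeasure_basic]
    · rfl
    · refine measure_mono_null ?_ (h.stoneMeasure_not_isSaturated a)
      intro Δ hΔ hs
      exact hΔ ((hP _).2 hs)
  have hfin : ∀ a Φ, IsFiniteMeasure (κ a Φ) := fun a Φ => ⟨by
    rw [← basic_top hcomp, hκ a Φ top]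
    exact ((hP _).1 Φ.2).rateSup_ne_top.lt_top⟩
  have hval : ∀ a φ, Measurable fun Φ => κ a Φ (basic P φ) := fun a φ => by
    simp_rw [hκ]
    exact measurable_rateSup (fun φ => measurableSet_basic φ) a φ
  refine ⟨⟨fun a => ⟨κ a, ?_⟩, hfin, isAnalyticMeasurableSpace hmeas⟩, hκ⟩
  have := hfin a
  refine Measurable.measure_of_isPiSystem rfl (isPiSystem_basic hcomp) ?_ ?_
  · rintro _ ⟨φ, rfl⟩
    exact hval a φ
  · rw [← basic_top hcomp]
    exact hval a top

end Formula

/-! ### Soundness -/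

namespace CMK

variable {A : Type*} {ℓ : CML} {M : Type*} [MeasurableSpace M]

theorem measurableSet_sat (K : CMK A M) (φ : Formula A ℓ) : MeasurableSet (φ.sat K) := by
  induction φ with
  | top => exact .univ
  | neg φ ih => exact ih.compl
  | and φ ψ ih ih' => exact ih.inter ih'
  | atLeast a r φ ih => exact measurableSet_le measurable_const ((K.rate a).measurable_coe ih)
  | atMost h a r φ ih => exact measurableSet_le ((K.rate a).measurable_coe ih) measurable_const

theorem isValuation_theory (K : CMK A M) (ℓ : CML) (m : M) : IsValuation (· ∈ K.theory ℓ m) :=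
  ⟨trivial, fun _ => Iff.rfl, fun _ _ => Iff.rfl⟩

theorem neg_mem_theory {K : CMK A M} {m : M} {φ : Formula A ℓ} :
    neg φ ∈ K.theory ℓ m ↔ φ ∉ K.theory ℓ m :=
  Iff.rfl

theorem atLeast_mem_theory {K : CMK A M} {m : M} {a : A} {r : ℚ≥0} {φ : Formula A ℓ} :
    atLeast a r φ ∈ K.theory ℓ m ↔ ((r : ℝ≥0) : ℝ≥0∞) ≤ K.rate a m (φ.sat K) :=
  Iff.rfl

theorem atMost_mem_theory {K : CMK A M} {m : M} {h : ℓ = CML.full} {a : A} {r : ℚ≥0}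
    {φ : Formula A ℓ} :
    atMost h a r φ ∈ K.theory ℓ m ↔ K.rate a m (φ.sat K) ≤ ((r : ℝ≥0) : ℝ≥0∞) :=
  Iff.rfl

/-- This is the soundness of `car`: conjunctions of initial segments of an enumeration of `Φ`
decrease to the intersection, and finite measures are continuous from above. -/
theorem le_rate_of_conjunctions [Countable A] (K : CMK A M) {Φ : Set (Formula A ℓ)} {a : A} {m : M}
    {x : ℝ≥0∞} {S : Set M} (hx : ∀ ψ ∈ conjunctions Φ, x ≤ K.rate a m (ψ.sat K))
    (hS : ⋂ ψ ∈ Φ, ψ.sat K ⊆ S) : x ≤ K.rate a m S := by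
  have := K.finite_rate a m
  refine le_trans ?_ (measure_mono hS)
  rcases Φ.eq_empty_or_nonempty with rfl | hne
  · simpa [sat] using hx top ⟨[], by simp, rfl⟩
  obtain ⟨f, hf⟩ := Φ.to_countable.exists_eq_range hne
  have heq : ⋂ ψ ∈ Φ, ψ.sat K = ⋂ n, (conj ((List.range (n + 1)).map f)).sat K := by
    ext n
    simp only [Set.mem_iInter]
    have hc : ∀ l : List (Formula A ℓ), n ∈ (conj l).sat K ↔ ∀ ψ ∈ l, n ∈ ψ.sat K := fun l =>
      (K.isValuation_theory ℓ n).conj l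
    simp only [hc, hf, List.mem_map, List.mem_range]
    constructor
    · rintro h i _ ⟨j, -, rfl⟩
      exact h _ ⟨j, rfl⟩
    · rintro h _ ⟨j, rfl⟩
      exact h j _ ⟨j, j.lt_succ_self, rfl⟩
  have hanti : Antitone fun n => (conj ((List.range (n + 1)).map f)).sat K := by
    intro i j hij n hn
    refine ((K.isValuation_theory ℓ n).conj _).2 fun ψ hψ =>
      ((K.isValuation_theory ℓ n).conj _).1 hn ψ ?_
    obtain ⟨k, hk, rfl⟩ := List.mem_map.1 hψ
    rw [List.mem_range] at hk
    exact List.mem_map.2 ⟨k, List.mem_range.2 (by lia), rfl⟩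
  rw [heq, hanti.measure_iInter (fun _ => (K.measurableSet_sat _).nullMeasurableSet)
    ⟨0, measure_ne_top _ _⟩]
  refine le_iInf fun n => hx _ ⟨_, fun ψ hψ => ?_, rfl⟩
  obtain ⟨k, -, rfl⟩ := List.mem_map.1 hψ
  exact hf ▸ ⟨k, rfl⟩

theorem rate_sat_and_add (K : CMK A M) (a : A) (m : M) (φ ψ : Formula A ℓ) :
    K.rate a m ((and φ ψ).sat K) + K.rate a m ((and φ (neg ψ)).sat K) = K.rate a m (φ.sat K) :=
  measure_inter_add_sdiff _ (K.measurableSet_sat ψ)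

theorem soundness [Countable A] (K : CMK A M) {Γ : Set (Formula A ℓ)} {φ : Formula A ℓ}
    (h : Provable Γ φ) : ∀ m, Γ ⊆ K.theory ℓ m → φ ∈ K.theory ℓ m := by
  induction h with
  | hyp h => exact fun m hΓ => hΓ h
  | cut _ _ ih ih' => exact fun m hΓ => ih' m fun ψ hψ => ih ψ hψ m hΓ
  | taut h =>
    have := fun m => K.isValuation_theory ℓ m
    exact fun m _ => h _ (this m).top (this m).neg (this m).and
  | modusPonens _ _ ih ih' =>
    exact fun m hΓ => ((K.isValuation_theory ℓ m).imp _ _).1 (ih m hΓ) (ih' m hΓ)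
  | deduction _ ih =>
    exact fun m hΓ => ((K.isValuation_theory ℓ m).imp _ _).2 fun hφ =>
      ih m (Set.insert_subset hφ hΓ)
  | atLeast_zero a φ => exact fun m _ => by simp [theory, sat]
  | not_atLeast_add a r s φ ψ =>
    refine fun m _ => ((K.isValuation_theory ℓ m).imp _ _).2 fun h => ?_
    obtain ⟨h1, h2⟩ := ((K.isValuation_theory ℓ m).and _ _).1 h
    rw [neg_mem_theory, atLeast_mem_theory, not_le] at h1 h2 ⊢
    rw [← rate_sat_and_add K a m φ ψ]
    push_cast
    exact ENNReal.add_lt_add h1 h2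
  | atLeast_mono a r _ ih =>
    refine fun m _ => ((K.isValuation_theory ℓ m).imp _ _).2 fun h1 => ?_
    exact le_trans (b := K.rate a m _) h1 (measure_mono fun n hn =>
      ((K.isValuation_theory ℓ n).imp _ _).1 (ih n (Set.empty_subset _)) hn)
  | atLeast_of_lt a s φ =>
    refine fun m hΓ => atLeast_mem_theory.2 (le_of_forall_lt fun c hc => ?_)
    obtain ⟨r, hr, hr'⟩ := ENNReal.exists_nnrat_btwn hc
    exact hr.trans_le (hΓ ⟨r, ENNReal.coe_nnrat_lt_coe.1 hr', rfl⟩)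
  | bot_of_gt a s φ =>
    intro m hΓ
    have := K.finite_rate a m
    -- A rational above both `s` and the actual rate gives a premise that is false at `m`.
    have hlt : K.rate a m (φ.sat K) ⊔ ((s : ℝ≥0) : ℝ≥0∞) < ∞ :=
      max_lt (measure_lt_top _ _) ENNReal.coe_lt_top
    obtain ⟨r, hr, -⟩ := ENNReal.exists_nnrat_btwn hlt
    have hmem : atLeast a r φ ∈ K.theory ℓ m :=
      hΓ ⟨r, ENNReal.coe_nnrat_lt_coe.1 ((le_max_right _ _).trans_lt hr), rfl⟩
    exact absurd hmem (not_le.2 ((le_max_left _ _).trans_lt hr))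
  | atLeast_le a r s φ _ =>
    refine fun m _ => ((K.isValuation_theory ℓ m).imp _ _).2 fun h1 => ?_
    exact le_trans (ENNReal.coe_nnrat_le_coe.2 le_self_add) h1
  | atLeast_add a r s φ ψ _ =>
    refine fun m _ => ((K.isValuation_theory ℓ m).imp _ _).2 fun ⟨h1, h2⟩ => ?_
    change (((r + s : ℚ≥0) : ℝ≥0) : ℝ≥0∞) ≤ K.rate a m (φ.sat K)
    rw [← rate_sat_and_add K a m φ ψ]
    push_cast
    exact add_le_add h1 h2
  | not_atMost_of_atLeast _ a r s φ hs =>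
    refine fun m _ => ((K.isValuation_theory ℓ m).imp _ _).2 fun h1 => ?_
    rw [neg_mem_theory, atMost_mem_theory, not_le]
    exact (ENNReal.coe_nnrat_lt_coe.2 (lt_add_of_pos_right r hs)).trans_le h1
  | atMost_of_not_atLeast _ a r φ =>
    refine fun m _ => ((K.isValuation_theory ℓ m).imp _ _).2 fun h1 => ?_
    rw [neg_mem_theory, atLeast_mem_theory, not_le] at h1
    exact h1.le
  | not_atMost_add _ a r s φ ψ =>
    refine fun m _ => ((K.isValuation_theory ℓ m).imp _ _).2 fun h => ?_
    obtain ⟨h1, h2⟩ := ((K.isValuation_theory ℓ m).and _ _).1 h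
    rw [neg_mem_theory, atMost_mem_theory, not_le] at h1 h2 ⊢
    rw [← rate_sat_and_add K a m φ ψ]
    push_cast
    exact ENNReal.add_lt_add h1 h2
  | atMost_of_gt _ a s φ =>
    refine fun m hΓ => atMost_mem_theory.2 (le_of_forall_gt fun c hc => ?_)
    obtain ⟨r, hr, hr'⟩ := ENNReal.exists_nnrat_btwn hc
    exact lt_of_le_of_lt (hΓ ⟨r, ENNReal.coe_nnrat_lt_coe.1 hr, rfl⟩) hr'
  | @car a r Φ φ _ ih =>
    intro m hΓ
    refine K.le_rate_of_conjunctions (fun ψ hψ => hΓ ⟨ψ, hψ, rfl⟩) fun n hn => ih n fun ψ hψ => ?_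
    exact Set.mem_iInter₂.1 hn ψ hψ

theorem maxConsistent_theory [Countable A] (K : CMK A M) (ℓ : CML) (m : M) :
    MaxConsistent (K.theory ℓ m) := by
  refine ⟨fun h => (K.isValuation_theory ℓ m).not_bot (K.soundness h m subset_rfl),
    fun φ hφ hc => hc ?_⟩
  refine .of_entails (Ξ := {φ, neg φ}) ?_ ?_
  · rintro ξ (rfl | rfl)
    · exact .hyp (Set.mem_insert _ _)
    · exact .hyp (Set.mem_insert_of_mem _ hφ)
  · intro v hv h
    exact absurd (h _ (.inl rfl)) ((hv.neg _).1 (h _ (.inr rfl)))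

theorem rate_sat_eq_rateSup (K : CMK A M) (a : A) (m : M) (φ : Formula A ℓ) :
    K.rate a m (φ.sat K) = rateSup (K.theory ℓ m) a φ := by
  refine le_antisymm (le_of_forall_lt fun c hc => ?_) (iSup₂_le fun r hr => hr)
  obtain ⟨r, hr, hr'⟩ := ENNReal.exists_nnrat_btwn hc
  exact hr.trans_le (le_rateSup (Γ := K.theory ℓ m) hr'.le)

end CMK

/-! ### The canonical model -/

namespace Formula

variable {A : Type*} {ℓ : CML}

/-- Truth lemma: the modal cases are exactly the rate characterizations `atLeast_mem_iff` and
`atMost_mem_iff` of saturated theories. -/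
theorem sat_eq_basic {P : Set (Formula A ℓ) → Prop} (hP : ∀ Φ, P Φ → IsSaturated Φ)
    {K : CMK A (TheorySpace P)}
    (hK : ∀ a Φ φ, K.rate a Φ (TheorySpace.basic P φ) = rateSup Φ.1 a φ) (φ : Formula A ℓ) :
    φ.sat K = TheorySpace.basic P φ := by
  induction φ with
  | top => exact (Set.eq_univ_of_forall fun Φ => (hP _ Φ.2).isValuation.top).symm
  | neg φ ih =>
    ext Φ
    simp [sat, ih, TheorySpace.basic, (hP _ Φ.2).isValuation.neg]
  | and φ ψ ih ih' =>
    ext Φ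
    simp [sat, ih, ih', TheorySpace.basic, (hP _ Φ.2).isValuation.and]
  | atLeast a r φ ih =>
    ext Φ
    simp only [sat, ih, hK]
    exact (hP _ Φ.2).atLeast_mem_iff.symm
  | atMost h a r φ ih =>
    ext Φ
    simp only [sat, ih, hK]
    exact ((hP _ Φ.2).atMost_mem_iff h).symm

theorem maxConsistent_iff_isSaturated [Countable A] {Γ : Set (Formula A ℓ)} :
    MaxConsistent Γ ↔ IsSaturated Γ := by
  refine ⟨MaxConsistent.isSaturated, fun h => ?_⟩
  -- The model is built on saturated theories first: realizing `Γ` as the theory of a state is what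
  -- shows it consistent.
  obtain ⟨K, hK⟩ := exists_cmk_rate_eq_rateSup (P := IsSaturated (A := A) (ℓ := ℓ)) fun _ => Iff.rfl
  have : K.theory ℓ ⟨Γ, h⟩ = Γ := Set.ext fun φ => by
    simp only [CMK.theory, sat_eq_basic (fun _ h => h) hK]
    rfl
  exact this ▸ K.maxConsistent_theory ℓ ⟨Γ, h⟩

theorem IsSaturated.isCanonicalRate_iff {Φ : CanonicalState A ℓ} (h : IsSaturated Φ.1) {a : A}
    {φ : Formula A ℓ} {x : ℝ≥0∞} : IsCanonicalRate Φ a φ x ↔ x = rateSup Φ.1 a φ := by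
  have hL : ∀ r, atLeast a r φ ∈ Φ.1 ↔ ((r : ℝ≥0) : ℝ≥0∞) ≤ rateSup Φ.1 a φ := fun r =>
    h.atLeast_mem_iff
  have hsup : IsLUB {y | ∃ r : ℚ≥0, atLeast a r φ ∈ Φ.1 ∧ y = ((r : ℝ≥0) : ℝ≥0∞)}
      (rateSup Φ.1 a φ) := by
    refine ⟨?_, fun b hb => iSup₂_le fun r hr => hb ⟨r, hr, rfl⟩⟩
    rintro _ ⟨r, hr, rfl⟩
    exact le_rateSup hr
  refine ⟨fun hx => hx.sup_atLeast.unique hsup, ?_⟩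
  rintro rfl
  refine ⟨hsup, ⟨?_, fun b hb => ?_⟩, fun hℓ => ⟨?_, fun b hb => ?_⟩, fun hℓ => ⟨?_, fun b hb => ?_⟩⟩
  · rintro _ ⟨r, hr, rfl⟩
    rw [h.isValuation.neg, hL, not_le] at hr
    exact hr.le
  · refine le_of_forall_gt fun c hc => ?_
    obtain ⟨r, hr, hr'⟩ := ENNReal.exists_nnrat_btwn hc
    refine (hb ⟨r, ?_, rfl⟩).trans_lt hr'
    rw [h.isValuation.neg, hL, not_le]
    exact hr
  · rintro _ ⟨r, hr, rfl⟩
    exact (h.atMost_mem_iff hℓ).1 hr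
  · refine le_of_forall_gt fun c hc => ?_
    obtain ⟨r, hr, hr'⟩ := ENNReal.exists_nnrat_btwn hc
    exact (hb ⟨r, (h.atMost_mem_iff hℓ).2 hr.le, rfl⟩).trans_lt hr'
  · rintro _ ⟨r, hr, rfl⟩
    rw [h.isValuation.neg, h.atMost_mem_iff hℓ, not_le] at hr
    exact hr.le
  · refine le_of_forall_lt fun c hc => ?_
    obtain ⟨r, hr, hr'⟩ := ENNReal.exists_nnrat_btwn hc
    refine hr.trans_le (hb ⟨r, ?_, rfl⟩)
    rw [h.isValuation.neg, h.atMost_mem_iff hℓ, not_le]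
    exact hr'

theorem isCanonicalModel_iff {K : CMK A (CanonicalState A ℓ)} :
    IsCanonicalModel K ↔ ∀ a Φ φ, K.rate a Φ (truthSet φ) = rateSup Φ.1 a φ :=
  forall_congr' fun _ => forall_congr' fun Φ => forall_congr' fun _ =>
    Φ.2.isSaturated.isCanonicalRate_iff

theorem canonical_measure_ext {μ ν : Measure (CanonicalState A ℓ)} [IsFiniteMeasure μ]
    (h : ∀ φ, μ (truthSet φ) = ν (truthSet φ)) : μ = ν :=
  @TheorySpace.measure_ext _ _ MaxConsistent (fun _ h => h.isSaturated.toIsComplete) μ ν ‹_› h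

theorem existsUnique_isCanonicalModel [Countable A] :
    ∃! K : CMK A (CanonicalState A ℓ), IsCanonicalModel K := by
  obtain ⟨K, hK⟩ := exists_cmk_rate_eq_rateSup (P := MaxConsistent (A := A) (ℓ := ℓ))
    fun _ => maxConsistent_iff_isSaturated
  refine ⟨K, isCanonicalModel_iff.2 hK, fun K' hK' => ?_⟩
  refine CMK.ext (funext fun a => Kernel.ext fun Φ => ?_)
  have := K'.finite_rate a Φ
  exact canonical_measure_ext fun φ => (isCanonicalModel_iff.1 hK' a Φ φ).trans (hK a Φ φ).symm

/-! ### The map to the canonical model and bisimilarity -/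

variable {M : Type*} [MeasurableSpace M]

/-- The map that sends a state to its theory. -/
def _root_.CMK.toCanonical [Countable A] (K : CMK A M) (ℓ : CML) (m : M) : CanonicalState A ℓ :=
  ⟨K.theory ℓ m, K.maxConsistent_theory ℓ m⟩

theorem _root_.CMK.measurable_toCanonical [Countable A] (K : CMK A M) (ℓ : CML) :
    Measurable (K.toCanonical ℓ) :=
  TheorySpace.measurable_of_mem (P := MaxConsistent) fun φ => K.measurableSet_sat φ

/-- Rates are preserved by the map to the canonical model. -/
theorem map_rate_toCanonical [Countable A] {C : CMK A (CanonicalState A ℓ)}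
    (hC : IsCanonicalModel C) (K : CMK A M) (a : A) (m : M) :
    (K.rate a m).map (K.toCanonical ℓ) = C.rate a (K.toCanonical ℓ m) := by
  have := K.finite_rate a m
  refine canonical_measure_ext fun φ => ?_
  refine Eq.trans ?_ (isCanonicalModel_iff.1 hC a _ φ).symm
  refine (Measure.map_apply (K.measurable_toCanonical ℓ)
    (TheorySpace.measurableSet_basic (P := MaxConsistent) φ)).trans ?_
  exact K.rate_sat_eq_rateSup a m φ

theorem bisimilar_toCanonical [Countable A] {C : CMK A (CanonicalState A ℓ)}
    (hC : IsCanonicalModel C) (K : CMK A M) (m : M) :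
    Bisimilar K m C (K.toCanonical ℓ m) := by
  -- Two states of the disjoint union are related when `t` agrees on them. A closed set `D` is then
  -- determined by its canonical part, and its rate from `x` depends only on `t x`.
  let t : M ⊕ CanonicalState A ℓ → CanonicalState A ℓ := Sum.elim (K.toCanonical ℓ) id
  refine ⟨fun x y => t x = t y, ⟨⟨fun _ => rfl, Eq.symm, Eq.trans⟩, ?_⟩, rfl⟩
  intro x y hxy D hD hR a
  have hD' := measurableSet_sum_iff.1 hD
  have hpre : Sum.inl ⁻¹' D = K.toCanonical ℓ ⁻¹' (Sum.inr ⁻¹' D) := by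
    ext n
    exact ⟨fun hn => hR ⟨Sum.inl n, hn, rfl⟩, fun hn => hR ⟨_, hn, rfl⟩⟩
  have key : ∀ x, (K.disjointUnion C).rate a x D = C.rate a (t x) (Sum.inr ⁻¹' D) := by
    rintro (n | Φ)
    · refine (Measure.map_apply measurable_inl hD).trans ?_
      rw [hpre, ← Measure.map_apply (K.measurable_toCanonical ℓ) hD'.2, map_rate_toCanonical hC]
      rfl
    · exact Measure.map_apply measurable_inr hD
  rw [key, key, show t x = t y from hxy]

end Formula

theorem mainTheorem8 (A : Type*) [Countable A] (ℓ : CML) :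
    (∃! C : CMK A (CanonicalState A ℓ), IsCanonicalModel C) ∧
    ∀ C : CMK A (CanonicalState A ℓ), IsCanonicalModel C →
      ∀ (M : Type*) [MeasurableSpace M] (K : CMK A M) (m : M),
        ∃ hΦ : Formula.MaxConsistent (K.theory ℓ m),
          Bisimilar K m C (⟨K.theory ℓ m, hΦ⟩ : CanonicalState A ℓ) :=
  ⟨existsUnique_isCanonicalModel, fun _ hC _ _ K m =>
    ⟨K.maxConsistent_theory ℓ m, bisimilar_toCanonical hC K m⟩⟩
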